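/- Let $(M,g)$ be a smooth $n$-dimensional Lorentzian manifold with signature $(-,+,\dots,+)$ and Levi-Civita connection $\nabla$. Let $\kappa$ be a smooth function and $\tau,\alpha,\beta$ smooth vector fields on $M$, identified with one-forms through $g$, such that $\tau$ is doubly torqued with data $(\kappa,\alpha,\beta)$, that is, $$\nabla_j\tau_k=\kappa\, g_{jk}+\alpha_j\tau_k+\tau_j\beta_k,\qquad \alpha_k\tau^k=0,\qquad \beta_k\tau^k=0 .$$ Conventions: $\nabla_j\nabla_k\omega_l-\nabla_k\nabla_j\omega_l=R_{jkl}{}^m\omega_m$, $R_{km}=g^{jl}R_{jklm}$, $R=g^{km}R_{km}$, and, for $n\ge 3$, the Weyl tensor is $$C_{jklm}=R_{jklm}+\frac{1}{n-2}\left(g_{jm}R_{kl}-g_{km}R_{jl}+g_{kl}R_{jm}-g_{jl}R_{km}\right)-\frac{R}{(n-1)(n-2)}\left(g_{jm}g_{kl}-g_{km}g_{jl}\right).$$ (1) If $n\ge 3$ and $\tau$ is timelike everywhere ($\tau_k\tau^k<0$), then $\tau$ is Weyl compatible: $$\tau_iC_{jklm}\tau^m+\tau_jC_{kilm}\tau^m+\tau_kC_{ijlm}\tau^m=0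 .$$ (2) If $\tau$ is null everywhere ($\tau_k\tau^k=0$ and $\tau$ vanishes nowhere), and if either $\alpha$ is closed ($\nabla_j\alpha_k=\nabla_k\alpha_j$) or $\beta=C\alpha$ for a real constant $C\neq 1$, then $\tau$ is Riemann compatible: $$\tau_iR_{jklm}\tau^m+\tau_jR_{kilm}\tau^m+\tau_kR_{ijlm}\tau^m=0,$$ and at every point $\tau$ is an eigenvector of the Ricci tensor: $\tau\neq0$ and $R_{km}\tau^m=\mu\,\tau_k$ for some real number $\mu$. -/

import Mathlib

open scoped Manifold ContDiff
open Bundle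

noncomputable section

namespace Spacetime

/-! ### Lorentzian metrics and one-forms on an `n`-dimensional manifold -/

/-- A smooth Lorentzian metric, of signature `(-, +, …, +)`, on an `n`-dimensional manifold. -/
structure LorentzMetric (n : ℕ) (M : Type*) [TopologicalSpace M]
    [ChartedSpace (EuclideanSpace ℝ (Fin n)) M] [IsManifold (𝓡 n) ∞ M] where
  /-- The scalar product on each tangent space. -/
  val (p : M) : TangentSpace (𝓡 n) p →L[ℝ] TangentSpace (𝓡 n) p →L[ℝ] ℝ
  symm (p : M) (v w : TangentSpace (𝓡 n) p) : val p v w = val p w v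
  /-- Every tangent space has an orthonormal basis with exactly one vector of square `-1`. -/
  lorentz (p : M) : ∃ (b : Module.Basis (Fin n) ℝ (TangentSpace (𝓡 n) p)) (i₀ : Fin n),
    ∀ i j, val p (b i) (b j) = if i = j then (if i = i₀ then -1 else 1) else 0
  contMDiff : ContMDiff (𝓡 n)
    ((𝓡 n).prod
      𝓘(ℝ, EuclideanSpace ℝ (Fin n) →L[ℝ] EuclideanSpace ℝ (Fin n) →L[ℝ] ℝ)) ∞
    (fun p ↦ TotalSpace.mk'
      (EuclideanSpace ℝ (Fin n) →L[ℝ] EuclideanSpace ℝ (Fin n) →L[ℝ] ℝ) p (val p))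

/-- A smooth one-form (a covector field). -/
structure OneForm (n : ℕ) (M : Type*) [TopologicalSpace M]
    [ChartedSpace (EuclideanSpace ℝ (Fin n)) M] [IsManifold (𝓡 n) ∞ M] where
  /-- The covector at each point. -/
  val (p : M) : TangentSpace (𝓡 n) p →L[ℝ] ℝ
  contMDiff : ContMDiff (𝓡 n) ((𝓡 n).prod 𝓘(ℝ, EuclideanSpace ℝ (Fin n) →L[ℝ] ℝ)) ∞
    (fun p ↦ TotalSpace.mk' (EuclideanSpace ℝ (Fin n) →L[ℝ] ℝ) p (val p))

section Components

variable {n : ℕ} {M : Type*} [TopologicalSpace M]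
  [ChartedSpace (EuclideanSpace ℝ (Fin n)) M] [IsManifold (𝓡 n) ∞ M]

/-- The coordinate vector `∂ᵢ` of the chart `e` at the point with coordinates `x`. -/
def coordVec (e : OpenPartialHomeomorph M (EuclideanSpace ℝ (Fin n)))
    (x : EuclideanSpace ℝ (Fin n)) (i : Fin n) : TangentSpace (𝓡 n) (e.symm x) :=
  mfderiv (𝓡 n) (𝓡 n) e.symm x (EuclideanSpace.single i (1 : ℝ))

/-- The components `gᵢⱼ = g(∂ᵢ, ∂ⱼ)` of the metric in the chart `e`, as functions of the
coordinates. -/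
def LorentzMetric.comp (g : LorentzMetric n M)
    (e : OpenPartialHomeomorph M (EuclideanSpace ℝ (Fin n)))
    (x : EuclideanSpace ℝ (Fin n)) : Matrix (Fin n) (Fin n) ℝ :=
  Matrix.of fun i j ↦ g.val (e.symm x) (coordVec e x i) (coordVec e x j)

/-- The components `ηᵢ = η(∂ᵢ)` of a one-form in the chart `e`, as functions of the
coordinates. -/
def OneForm.comp (η : OneForm n M)
    (e : OpenPartialHomeomorph M (EuclideanSpace ℝ (Fin n)))
    (x : EuclideanSpace ℝ (Fin n)) (i : Fin n) : ℝ :=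
  η.val (e.symm x) (coordVec e x i)

end Components

/-! ### Classical tensor calculus in coordinates

Here `G x i j` are the components of a metric and `η x i` those of a covector field,
as functions of the coordinates `x`. -/

section Coordinates

variable {n : ℕ}

/-- The partial derivative `∂ᵢ f` at `x`. -/
def pd (i : Fin n) (f : EuclideanSpace ℝ (Fin n) → ℝ) (x : EuclideanSpace ℝ (Fin n)) : ℝ :=
  fderiv ℝ f x (EuclideanSpace.single i (1 : ℝ))

variable (G : EuclideanSpace ℝ (Fin n) → Matrix (Fin n) (Fin n) ℝ)

/-- The Christoffel symbol `Γᵏᵢⱼ` of the Levi-Civita connection. -/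
def christoffel (k i j : Fin n) (x : EuclideanSpace ℝ (Fin n)) : ℝ :=
  1 / 2 * ∑ l, (G x)⁻¹ k l *
    (pd i (fun y ↦ G y j l) x + pd j (fun y ↦ G y i l) x - pd l (fun y ↦ G y i j) x)

/-- The covariant derivative `∇ⱼ ηₖ`. -/
def covDeriv (η : EuclideanSpace ℝ (Fin n) → Fin n → ℝ) (j k : Fin n)
    (x : EuclideanSpace ℝ (Fin n)) : ℝ :=
  pd j (fun y ↦ η y k) x - ∑ m, christoffel G m j k x * η x m

/-- The index raised: `ηᵐ = gᵐᵏ ηₖ`. -/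
def raise (η : EuclideanSpace ℝ (Fin n) → Fin n → ℝ) (x : EuclideanSpace ℝ (Fin n))
    (m : Fin n) : ℝ :=
  ∑ k, (G x)⁻¹ m k * η x k

/-- The scalar product `ηₖ ζᵏ` of two covector fields. -/
def contract (η ζ : EuclideanSpace ℝ (Fin n) → Fin n → ℝ) (x : EuclideanSpace ℝ (Fin n)) : ℝ :=
  ∑ k, η x k * raise G ζ x k

/-- The curvature tensor `Rⱼₖₗᵖ`, with the sign fixed by
`∇ⱼ ∇ₖ ηₗ - ∇ₖ ∇ⱼ ηₗ = Rⱼₖₗᵖ ηₚ`. -/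
def riemannUp (j k l p : Fin n) (x : EuclideanSpace ℝ (Fin n)) : ℝ :=
  -(pd j (christoffel G p k l) x - pd k (christoffel G p j l) x
    + ∑ q, (christoffel G p j q x * christoffel G q k l x
      - christoffel G p k q x * christoffel G q j l x))

/-- The Riemann tensor `Rⱼₖₗₘ = Rⱼₖₗᵖ gₚₘ`. -/
def riemann (j k l m : Fin n) (x : EuclideanSpace ℝ (Fin n)) : ℝ :=
  ∑ p, riemannUp G j k l p x * G x p m

/-- The Ricci tensor `Rₖₘ = gʲˡ Rⱼₖₗₘ`. -/
def ricci (k m : Fin n) (x : EuclideanSpace ℝ (Fin n)) : ℝ :=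
  ∑ j, ∑ l, (G x)⁻¹ j l * riemann G j k l m x

/-- The scalar curvature `R = gᵏᵐ Rₖₘ`. -/
def scalarCurv (x : EuclideanSpace ℝ (Fin n)) : ℝ :=
  ∑ k, ∑ m, (G x)⁻¹ k m * ricci G k m x

/-- The Weyl tensor `Cⱼₖₗₘ`; it is meaningful in dimension `n ≥ 3`. -/
def weyl (j k l m : Fin n) (x : EuclideanSpace ℝ (Fin n)) : ℝ :=
  riemann G j k l m x
    + 1 / ((n : ℝ) - 2) * (G x j m * ricci G k l x - G x k m * ricci G j l x
      + G x k l * ricci G j m x - G x j l * ricci G k m x)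
    - scalarCurv G x / (((n : ℝ) - 1) * ((n : ℝ) - 2))
      * (G x j m * G x k l - G x k m * G x j l)

end Coordinates

/-! ### The notions of the theorem

Tensor equations are required in every chart of the maximal smooth atlas. -/

section Notions

variable {n : ℕ} {M : Type*} [TopologicalSpace M]
  [ChartedSpace (EuclideanSpace ℝ (Fin n)) M] [IsManifold (𝓡 n) ∞ M]

/-- `τ` is doubly torqued with data `κ, α, β`:
`∇ⱼ τₖ = κ gⱼₖ + αⱼ τₖ + τⱼ βₖ`, `αₖ τᵏ = 0`, `βₖ τᵏ = 0`. -/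
def IsDoublyTorqued (g : LorentzMetric n M) (τ : OneForm n M) (κ : M → ℝ)
    (α β : OneForm n M) : Prop :=
  ∀ e ∈ IsManifold.maximalAtlas (𝓡 n) ∞ M, ∀ x ∈ e.target,
    (∀ j k, covDeriv (g.comp e) (τ.comp e) j k x =
      κ (e.symm x) * g.comp e x j k + α.comp e x j * τ.comp e x k
        + τ.comp e x j * β.comp e x k) ∧
    contract (g.comp e) (α.comp e) (τ.comp e) x = 0 ∧
    contract (g.comp e) (β.comp e) (τ.comp e) x = 0

/-- `τ` is timelike everywhere: `τₖ τᵏ < 0`. -/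
def IsTimelike (g : LorentzMetric n M) (τ : OneForm n M) : Prop :=
  ∀ e ∈ IsManifold.maximalAtlas (𝓡 n) ∞ M, ∀ x ∈ e.target,
    contract (g.comp e) (τ.comp e) (τ.comp e) x < 0

/-- `τ` is null everywhere: it vanishes nowhere and `τₖ τᵏ = 0`. -/
def IsNull (g : LorentzMetric n M) (τ : OneForm n M) : Prop :=
  (∀ p, τ.val p ≠ 0) ∧
  ∀ e ∈ IsManifold.maximalAtlas (𝓡 n) ∞ M, ∀ x ∈ e.target,
    contract (g.comp e) (τ.comp e) (τ.comp e) x = 0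

/-- The one-form `η` is closed: `∂ⱼ ηₖ = ∂ₖ ηⱼ`. -/
def IsClosedForm (η : OneForm n M) : Prop :=
  ∀ e ∈ IsManifold.maximalAtlas (𝓡 n) ∞ M, ∀ x ∈ e.target, ∀ j k,
    pd j (fun y ↦ η.comp e y k) x = pd k (fun y ↦ η.comp e y j) x

/-- Weyl compatibility: `τᵢ Cⱼₖₗₘ τᵐ + τⱼ Cₖᵢₗₘ τᵐ + τₖ Cᵢⱼₗₘ τᵐ = 0`. -/
def IsWeylCompatible (g : LorentzMetric n M) (τ : OneForm n M) : Prop :=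
  ∀ e ∈ IsManifold.maximalAtlas (𝓡 n) ∞ M, ∀ x ∈ e.target, ∀ i j k l,
    τ.comp e x i * ∑ m, weyl (g.comp e) j k l m x * raise (g.comp e) (τ.comp e) x m
      + τ.comp e x j * ∑ m, weyl (g.comp e) k i l m x * raise (g.comp e) (τ.comp e) x m
      + τ.comp e x k * ∑ m, weyl (g.comp e) i j l m x * raise (g.comp e) (τ.comp e) x m = 0

/-- Riemann compatibility: `τᵢ Rⱼₖₗₘ τᵐ + τⱼ Rₖᵢₗₘ τᵐ + τₖ Rᵢⱼₗₘ τᵐ = 0`. -/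
def IsRiemannCompatible (g : LorentzMetric n M) (τ : OneForm n M) : Prop :=
  ∀ e ∈ IsManifold.maximalAtlas (𝓡 n) ∞ M, ∀ x ∈ e.target, ∀ i j k l,
    τ.comp e x i * ∑ m, riemann (g.comp e) j k l m x * raise (g.comp e) (τ.comp e) x m
      + τ.comp e x j * ∑ m, riemann (g.comp e) k i l m x * raise (g.comp e) (τ.comp e) x m
      + τ.comp e x k * ∑ m, riemann (g.comp e) i j l m x * raise (g.comp e) (τ.comp e) x m = 0

/-- `τ` is at every point an eigenvector of the Ricci tensor: `τ ≠ 0` and `Rₖₘ τᵐ = μ τₖ`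
for some real number `μ`. -/
def IsRicciEigenvector (g : LorentzMetric n M) (τ : OneForm n M) : Prop :=
  (∀ p, τ.val p ≠ 0) ∧
  ∀ e ∈ IsManifold.maximalAtlas (𝓡 n) ∞ M, ∀ x ∈ e.target, ∃ μ : ℝ, ∀ k,
    ∑ m, ricci (g.comp e) k m x * raise (g.comp e) (τ.comp e) x m = μ * τ.comp e x k

end Notions

end Spacetime

end

open Spacetime

/-! In a chart, write `A = dκ - κα` and `Sⱼₖ = βⱼβₖ - ∇ⱼβₖ`. Applying the Ricci identity to the
torqued equation gives (`sum_riemannUp_mul_eq`) `Rᵢⱼₖᵖτₚ = Aᵢgⱼₖ - Aⱼgᵢₖ + (dα)ᵢⱼτₖ + τᵢSⱼₖ -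
τⱼSᵢₖ`. In the cyclic sum with `τ` the `S` terms cancel, so the obstructions are the `A` terms and
`τ ∧ dα`.

Let `N = τₖτᵏ`; then `dN = 2(κτ + Nα)`. If `N ≠ 0`, `d²N = 0` gives `N dα = τ ∧ (A - κβ)`
(`curl_mul_contract`), so `τ ∧ dα = 0`. Tracing the curvature formula then gives `Ric(τ) = -(n-2)A +
tτ`, and the Ricci terms of the Weyl tensor cancel exactly the `A` terms.

If `N` vanishes identically, `κτ = 0` forces `κ = 0` and `A = 0`, leaving only `τ ∧ dα`. It vanishes
for closed `α`. The first Bianchi identity gives `τ ∧ (dα - dβ) = 0` (`curl_cyclic`), so `β = Cα`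
with `C ≠ 1` also suffices. Contracting `τ ∧ dα = 0` with the null `τ` makes the contraction of `dα`
with `τ` proportional to `τ`, hence the Ricci eigenvector. -/

namespace Spacetime

/-! ### Smoothness and nondegeneracy of chart components -/

section ChartComponents

variable {n : ℕ} {M : Type*} [TopologicalSpace M]
  [ChartedSpace (EuclideanSpace ℝ (Fin n)) M] [IsManifold (𝓡 n) ∞ M]
  {e : OpenPartialHomeomorph M (EuclideanSpace ℝ (Fin n))}
  {x : EuclideanSpace ℝ (Fin n)}

/-- The field `∂ᵢ` is the tangent map of the smooth inverse chart applied to a constant field. -/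
theorem contMDiffAt_coordVec (he : e ∈ IsManifold.maximalAtlas (𝓡 n) ∞ M) (hx : x ∈ e.target)
    (i : Fin n) :
    ContMDiffAt (𝓡 n) (𝓡 n).tangent ∞
      (fun y ↦ TotalSpace.mk' (EuclideanSpace ℝ (Fin n)) (E := TangentSpace (𝓡 n) (M := M))
        (e.symm y) (coordVec e y i)) x := by
  have h1 : ContMDiffOn (𝓡 n) (𝓡 n) ∞ e.symm e.target := contMDiffOn_symm_of_mem_maximalAtlas he
  have h2 := h1.contMDiffOn_tangentMapWithin (m := ∞) (by simp) e.open_target.uniqueMDiffOn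
  have h3 : ContMDiff (𝓡 n) (𝓡 n).tangent ∞ (fun y : EuclideanSpace ℝ (Fin n) ↦
      TotalSpace.mk' (EuclideanSpace ℝ (Fin n))
        (E := TangentSpace (𝓡 n) (M := EuclideanSpace ℝ (Fin n)))
        y (EuclideanSpace.single i (1 : ℝ))) := by
    exact (contMDiff_vectorSpace_iff_contDiff (𝕜 := ℝ)
      (V := fun _ : EuclideanSpace ℝ (Fin n) ↦ (EuclideanSpace.single i (1 : ℝ) :
        EuclideanSpace ℝ (Fin n)))).2 contDiff_const
  have h4 := h2.comp h3.contMDiffOn (s := e.target) (fun y hy ↦ hy)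
  refine (h4.contMDiffAt (e.open_target.mem_nhds hx)).congr_of_eventuallyEq ?_
  filter_upwards [e.open_target.mem_nhds hx] with y hy
  simp [tangentMapWithin, coordVec, mfderivWithin_of_isOpen e.open_target hy]

theorem OneForm.contDiffAt_comp (η : OneForm n M)
    (he : e ∈ IsManifold.maximalAtlas (𝓡 n) ∞ M) (hx : x ∈ e.target) (i : Fin n) :
    ContDiffAt ℝ ∞ (fun y ↦ η.comp e y i) x := by
  have h1 : ContMDiffAt (𝓡 n) (𝓡 n) ∞ e.symm x := contMDiffAt_symm_of_mem_maximalAtlas he hx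
  have h2 := (η.contMDiff (e.symm x)).comp x h1
  -- A scalar function is treated as a section of the trivial line bundle, so that smooth bundle
  -- evaluation applies.
  have h3 : ContMDiffAt (𝓡 n) ((𝓡 n).prod 𝓘(ℝ, ℝ)) ∞
      (fun y ↦ TotalSpace.mk' ℝ (E := Bundle.Trivial M ℝ) (e.symm y)
        (η.val (e.symm y) (coordVec e y i))) x := by
    apply ContMDiffAt.clm_bundle_apply (F₁ := EuclideanSpace ℝ (Fin n))
      (E₁ := TangentSpace (𝓡 n) (M := M))
    · exact h2
    · exact contMDiffAt_coordVec he hx i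
  rw [contMDiffAt_totalSpace] at h3
  exact h3.2.contDiffAt

theorem LorentzMetric.contDiffAt_comp (g : LorentzMetric n M)
    (he : e ∈ IsManifold.maximalAtlas (𝓡 n) ∞ M) (hx : x ∈ e.target) (i j : Fin n) :
    ContDiffAt ℝ ∞ (fun y ↦ g.comp e y i j) x := by
  have h1 : ContMDiffAt (𝓡 n) (𝓡 n) ∞ e.symm x := contMDiffAt_symm_of_mem_maximalAtlas he hx
  have h2 := (g.contMDiff (e.symm x)).comp x h1
  have h3 : ContMDiffAt (𝓡 n) ((𝓡 n).prod 𝓘(ℝ, ℝ)) ∞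
      (fun y ↦ TotalSpace.mk' ℝ (E := Bundle.Trivial M ℝ) (e.symm y)
        (g.val (e.symm y) (coordVec e y i) (coordVec e y j))) x := by
    apply ContMDiffAt.clm_bundle_apply₂ (F₁ := EuclideanSpace ℝ (Fin n))
      (F₂ := EuclideanSpace ℝ (Fin n)) (E₁ := TangentSpace (𝓡 n) (M := M))
      (E₂ := TangentSpace (𝓡 n) (M := M))
    · exact h2
    · exact contMDiffAt_coordVec he hx i
    · exact contMDiffAt_coordVec he hx j
  rw [contMDiffAt_totalSpace] at h3
  exact h3.2.contDiffAt

omit [IsManifold (𝓡 n) ∞ M] in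
theorem contDiffAt_comp_symm {κ : M → ℝ} (hκ : ContMDiff (𝓡 n) 𝓘(ℝ, ℝ) ∞ κ)
    (he : e ∈ IsManifold.maximalAtlas (𝓡 n) ∞ M) (hx : x ∈ e.target) :
    ContDiffAt ℝ ∞ (fun y ↦ κ (e.symm y)) x :=
  ((hκ (e.symm x)).comp x (contMDiffAt_symm_of_mem_maximalAtlas he hx)).contDiffAt

omit [IsManifold (𝓡 n) ∞ M] in
theorem mfderiv_symm_bijective (he : e ∈ IsManifold.maximalAtlas (𝓡 n) ∞ M) (hx : x ∈ e.target) :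
    Function.Bijective (mfderiv (𝓡 n) (𝓡 n) e.symm x) := by
  have he' : e.symm.MDifferentiable (𝓡 n) (𝓡 n) :=
    ⟨fun y hy ↦ ((contMDiffAt_symm_of_mem_maximalAtlas (n := ∞) he hy).mdifferentiableAt
      (by simp)).mdifferentiableWithinAt,
      fun y hy ↦ ((contMDiffAt_of_mem_maximalAtlas (n := ∞) he (by simpa using hy)).mdifferentiableAt
      (by simp)).mdifferentiableWithinAt⟩
  exact he'.mfderiv_bijective (by simpa using hx)

omit [IsManifold (𝓡 n) ∞ M] in
theorem sum_smul_coordVec (c : Fin n → ℝ) :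
    mfderiv (𝓡 n) (𝓡 n) e.symm x (WithLp.toLp 2 c) = ∑ i, c i • coordVec e x i := by
  have h : (WithLp.toLp 2 c : EuclideanSpace ℝ (Fin n)) =
      ∑ i, c i • EuclideanSpace.single i (1 : ℝ) := by
    ext j
    simp [Finset.sum_apply, Pi.single_apply]
  have := map_sum (mfderiv (𝓡 n) (𝓡 n) e.symm x)
    (fun i ↦ c i • (EuclideanSpace.single i (1 : ℝ) : EuclideanSpace ℝ (Fin n))) Finset.univ
  unfold coordVec
  rw [h]
  refine this.trans (Finset.sum_congr rfl fun i _ ↦ ?_)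
  exact map_smul _ _ _

omit [IsManifold (𝓡 n) ∞ M] in
theorem exists_eq_sum_smul_coordVec (he : e ∈ IsManifold.maximalAtlas (𝓡 n) ∞ M)
    (hx : x ∈ e.target) (w : TangentSpace (𝓡 n) (e.symm x)) :
    ∃ c : Fin n → ℝ, w = ∑ i, c i • coordVec e x i := by
  obtain ⟨d, rfl⟩ := (mfderiv_symm_bijective he hx).2 w
  exact ⟨WithLp.ofLp (p := 2) d, sum_smul_coordVec _⟩

theorem LorentzMetric.comp_symm (g : LorentzMetric n M) (i j : Fin n) :
    g.comp e x i j = g.comp e x j i := g.symm _ _ _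

theorem LorentzMetric.nondegenerate (g : LorentzMetric n M) {p : M} {v : TangentSpace (𝓡 n) p}
    (h : ∀ w, g.val p v w = 0) : v = 0 := by
  obtain ⟨b, i₀, hb⟩ := g.lorentz p
  apply b.ext_elem
  intro i
  have h1 := h (b i)
  rw [← b.sum_repr v] at h1
  simp only [map_sum, map_smul, sum_apply, smul_apply, hb,
    smul_eq_mul, mul_ite, mul_zero, Finset.sum_ite_eq', Finset.mem_univ, if_true] at h1
  -- Pairing with `b i` returns the `i`-th coordinate of `v` up to sign.
  split_ifs at h1 <;> simpa using h1

/-- A null vector of the Gram matrix would give a tangent vector orthogonal to all `∂ⱼ`, which span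
the tangent space. -/
theorem LorentzMetric.det_comp_ne_zero (g : LorentzMetric n M)
    (he : e ∈ IsManifold.maximalAtlas (𝓡 n) ∞ M) (hx : x ∈ e.target) :
    (g.comp e x).det ≠ 0 := by
  intro h0
  obtain ⟨c, hc, hc0⟩ := Matrix.exists_vecMul_eq_zero_iff.mpr h0
  apply hc
  have hv : mfderiv (𝓡 n) (𝓡 n) e.symm x (WithLp.toLp 2 c) = 0 := by
    apply g.nondegenerate
    intro w
    obtain ⟨d, rfl⟩ := exists_eq_sum_smul_coordVec he hx w
    rw [sum_smul_coordVec, map_sum]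
    refine Finset.sum_eq_zero fun j _ ↦ ?_
    have := congrFun hc0 j
    simp only [Matrix.vecMul, dotProduct, LorentzMetric.comp, Matrix.of_apply, Pi.zero_apply]
      at this
    simp only [map_sum, map_smul, sum_apply, smul_apply,
      smul_eq_mul, this, mul_zero]
  have := (mfderiv_symm_bijective he hx).1 (hv.trans (map_zero _).symm)
  exact congrArg WithLp.ofLp this

theorem OneForm.exists_comp_ne_zero (η : OneForm n M) (hη : ∀ p, η.val p ≠ 0)
    (he : e ∈ IsManifold.maximalAtlas (𝓡 n) ∞ M) (hx : x ∈ e.target) :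
    ∃ i, η.comp e x i ≠ 0 := by
  by_contra! h
  refine hη (e.symm x) (ContinuousLinearMap.ext fun w ↦ ?_)
  obtain ⟨d, rfl⟩ := exists_eq_sum_smul_coordVec he hx w
  rw [map_sum]
  refine Finset.sum_eq_zero fun j _ ↦ ?_
  rw [map_smul]
  exact smul_eq_zero_of_right _ (h j)

end ChartComponents

/-! ### Rules for partial derivatives -/

section PartialDerivatives

variable {n : ℕ} {f h : EuclideanSpace ℝ (Fin n) → ℝ} {x : EuclideanSpace ℝ (Fin n)}

theorem pd_congr (hfh : f =ᶠ[nhds x] h) (i : Fin n) : pd i f x = pd i h x := by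
  simp only [pd, hfh.fderiv_eq]

theorem pd_const (i : Fin n) (c : ℝ) : pd i (fun _ ↦ c) x = 0 := by
  simp [pd]

theorem pd_add (hf : ContDiffAt ℝ ∞ f x) (hh : ContDiffAt ℝ ∞ h x) (i : Fin n) :
    pd i (fun y ↦ f y + h y) x = pd i f x + pd i h x := by
  simp [pd, fderiv_fun_add (hf.differentiableAt (by simp)) (hh.differentiableAt (by simp))]

theorem pd_sub (hf : ContDiffAt ℝ ∞ f x) (hh : ContDiffAt ℝ ∞ h x) (i : Fin n) :
    pd i (fun y ↦ f y - h y) x = pd i f x - pd i h x := by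
  simp [pd, fderiv_fun_sub (hf.differentiableAt (by simp)) (hh.differentiableAt (by simp))]

theorem pd_mul (hf : ContDiffAt ℝ ∞ f x) (hh : ContDiffAt ℝ ∞ h x) (i : Fin n) :
    pd i (fun y ↦ f y * h y) x = pd i f x * h x + f x * pd i h x := by
  simp only [pd, fderiv_fun_mul (hf.differentiableAt (by simp)) (hh.differentiableAt (by simp)),
    add_apply, smul_apply, smul_eq_mul]
  ring

theorem pd_sum {ι : Type*} {s : Finset ι} {F : ι → EuclideanSpace ℝ (Fin n) → ℝ}
    (hF : ∀ a ∈ s, ContDiffAt ℝ ∞ (F a) x) (i : Fin n) :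
    pd i (fun y ↦ ∑ a ∈ s, F a y) x = ∑ a ∈ s, pd i (F a) x := by
  simp [pd, fderiv_fun_sum fun a ha ↦ (hF a ha).differentiableAt (by simp)]

theorem contDiffAt_pd (hf : ContDiffAt ℝ ∞ f x) (i : Fin n) : ContDiffAt ℝ ∞ (pd i f) x :=
  (hf.fderiv_right (m := ∞) (by simp)).clm_apply contDiffAt_const

theorem pd_comm (hf : ContDiffAt ℝ ∞ f x) (i j : Fin n) :
    pd i (pd j f) x = pd j (pd i f) x := by
  have hd : DifferentiableAt ℝ (fderiv ℝ f) x :=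
    (hf.fderiv_right (m := ∞) (by simp)).differentiableAt (by simp)
  have key (a b : Fin n) : pd a (pd b f) x =
      fderiv ℝ (fderiv ℝ f) x (EuclideanSpace.single a 1) (EuclideanSpace.single b 1) := by
    change fderiv ℝ (fun y ↦ fderiv ℝ f y (EuclideanSpace.single b 1)) x _ = _
    rw [fderiv_clm_apply hd (differentiableAt_const _)]
    simp
  rw [key, key]
  exact (hf.isSymmSndFDerivAt (by simpa using WithTop.coe_le_coe.2 (le_top (a := (2 : ℕ∞))))) _ _

end PartialDerivatives

/-! ### Levi-Civita calculus in coordinates -/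

section MetricCalculus

variable {n : ℕ}

theorem contDiffAt_det {A : EuclideanSpace ℝ (Fin n) → Matrix (Fin n) (Fin n) ℝ}
    {x : EuclideanSpace ℝ (Fin n)} (hA : ∀ i j, ContDiffAt ℝ ∞ (fun y ↦ A y i j) x) :
    ContDiffAt ℝ ∞ (fun y ↦ (A y).det) x := by
  simp only [Matrix.det_apply]
  exact ContDiffAt.sum fun σ _ ↦ (contDiffAt_prod fun i _ ↦ hA _ _).const_smul _

theorem contDiffAt_inv {A : EuclideanSpace ℝ (Fin n) → Matrix (Fin n) (Fin n) ℝ}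
    {x : EuclideanSpace ℝ (Fin n)} (hA : ∀ i j, ContDiffAt ℝ ∞ (fun y ↦ A y i j) x)
    (hdet : (A x).det ≠ 0) (i j : Fin n) : ContDiffAt ℝ ∞ (fun y ↦ (A y)⁻¹ i j) x := by
  simp only [Matrix.inv_def, Matrix.smul_apply, Ring.inverse_eq_inv', smul_eq_mul,
    Matrix.adjugate_apply]
  -- Each cofactor is the determinant of `A` with row `j` replaced by a constant row.
  refine ((contDiffAt_det hA).inv hdet).mul (contDiffAt_det fun k l ↦ ?_)
  by_cases hk : k = j
  · subst hk
    simpa using contDiffAt_const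
  · simpa [Matrix.updateRow_ne hk] using hA k l

/-- `G` is a smooth, symmetric and nondegenerate matrix field on the open set `U`. -/
structure IsMetricOn (G : EuclideanSpace ℝ (Fin n) → Matrix (Fin n) (Fin n) ℝ)
    (U : Set (EuclideanSpace ℝ (Fin n))) : Prop where
  isOpen : IsOpen U
  contDiffAt : ∀ x ∈ U, ∀ i j, ContDiffAt ℝ ∞ (fun y ↦ G y i j) x
  symm : ∀ x i j, G x i j = G x j i
  det_ne_zero : ∀ x ∈ U, (G x).det ≠ 0

/-- `η` is a smooth covector field on `U`. -/
def SmoothOn (η : EuclideanSpace ℝ (Fin n) → Fin n → ℝ) (U : Set (EuclideanSpace ℝ (Fin n))) :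
    Prop :=
  ∀ x ∈ U, ∀ i, ContDiffAt ℝ ∞ (fun y ↦ η y i) x

variable {G : EuclideanSpace ℝ (Fin n) → Matrix (Fin n) (Fin n) ℝ}
  {U : Set (EuclideanSpace ℝ (Fin n))} {x : EuclideanSpace ℝ (Fin n)}
  {η ζ : EuclideanSpace ℝ (Fin n) → Fin n → ℝ}

namespace IsMetricOn

theorem inv_symm (hG : IsMetricOn G U) (i j : Fin n) : (G x)⁻¹ i j = (G x)⁻¹ j i := by
  have h : (G x).transpose = G x := Matrix.ext fun i j ↦ hG.symm x j i
  conv_rhs => rw [← h, ← Matrix.transpose_nonsing_inv, Matrix.transpose_apply]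

theorem sum_inv_mul (hG : IsMetricOn G U) (hx : x ∈ U) (i j : Fin n) :
    ∑ k, (G x)⁻¹ i k * G x k j = if i = j then 1 else 0 := by
  rw [← Matrix.mul_apply, Matrix.nonsing_inv_mul _ (hG.det_ne_zero x hx).isUnit, Matrix.one_apply]

theorem contDiffAt_christoffel (hG : IsMetricOn G U) (hx : x ∈ U) (k i j : Fin n) :
    ContDiffAt ℝ ∞ (christoffel G k i j) x := by
  unfold christoffel
  refine contDiffAt_const.mul (ContDiffAt.sum fun l _ ↦
    (contDiffAt_inv (hG.contDiffAt x hx) (hG.det_ne_zero x hx) k l).mul ?_)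
  exact ((contDiffAt_pd (hG.contDiffAt x hx _ _) _).add
    (contDiffAt_pd (hG.contDiffAt x hx _ _) _)).sub (contDiffAt_pd (hG.contDiffAt x hx _ _) _)

theorem contDiffAt_raise (hG : IsMetricOn G U) (hη : SmoothOn η U) (hx : x ∈ U) (m : Fin n) :
    ContDiffAt ℝ ∞ (fun y ↦ raise G η y m) x :=
  ContDiffAt.sum fun l _ ↦
    (contDiffAt_inv (hG.contDiffAt x hx) (hG.det_ne_zero x hx) m l).mul (hη x hx l)

theorem contDiffAt_contract (hG : IsMetricOn G U) (hη : SmoothOn η U) (hζ : SmoothOn ζ U)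
    (hx : x ∈ U) : ContDiffAt ℝ ∞ (contract G η ζ) x :=
  ContDiffAt.sum fun l _ ↦ (hη x hx l).mul (hG.contDiffAt_raise hζ hx l)

theorem christoffel_symm (hG : IsMetricOn G U) (k i j : Fin n) (x : EuclideanSpace ℝ (Fin n)) :
    christoffel G k i j x = christoffel G k j i x := by
  unfold christoffel
  -- Symmetry holds at every point, so it may be used under the derivative.
  simp only [fun y ↦ hG.symm y i j]
  congr 1
  exact Finset.sum_congr rfl fun l _ ↦ by ring

theorem sum_raise_mul (hG : IsMetricOn G U) (hx : x ∈ U) (η) (l : Fin n) :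
    ∑ k, raise G η x k * G x k l = η x l := by
  simp only [raise, Finset.sum_mul]
  rw [Finset.sum_comm]
  have h (k : Fin n) : ∑ m, (G x)⁻¹ m k * η x k * G x m l = η x k * if k = l then 1 else 0 := by
    rw [← hG.sum_inv_mul hx k l, Finset.mul_sum]
    exact Finset.sum_congr rfl fun m _ ↦ by rw [hG.inv_symm m k]; ring
  simp [h]

theorem sum_christoffel_mul (hG : IsMetricOn G U) (hx : x ∈ U) (i j l : Fin n) :
    ∑ k, christoffel G k i j x * G x k l = 1 / 2 *
      (pd i (fun y ↦ G y j l) x + pd j (fun y ↦ G y i l) x - pd l (fun y ↦ G y i j) x) := by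
  -- The Christoffel symbol is this covector with its index `l` raised; lowering undoes that.
  have h := hG.sum_raise_mul hx (fun _ l ↦ 1 / 2 *
      (pd i (fun y ↦ G y j l) x + pd j (fun y ↦ G y i l) x - pd l (fun y ↦ G y i j) x)) l
  rw [← h]
  refine Finset.sum_congr rfl fun k _ ↦ ?_
  simp only [christoffel, raise, Finset.mul_sum]
  congr 1
  exact Finset.sum_congr rfl fun m _ ↦ by ring

/-- The metric is covariantly constant. -/
theorem pd_metric (hG : IsMetricOn G U) (hx : x ∈ U) (i j k : Fin n) :
    pd i (fun y ↦ G y j k) x =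
      ∑ m, christoffel G m i j x * G x m k + ∑ m, christoffel G m i k x * G x j m := by
  simp only [hG.symm x j]
  rw [hG.sum_christoffel_mul hx, hG.sum_christoffel_mul hx]
  simp only [fun y ↦ hG.symm y k j]
  ring

theorem contract_comm (hG : IsMetricOn G U) (η ζ) : contract G η ζ x = contract G ζ η x := by
  simp only [contract, raise, Finset.mul_sum]
  rw [Finset.sum_comm]
  exact Finset.sum_congr rfl fun i _ ↦ Finset.sum_congr rfl fun j _ ↦ by
    rw [hG.inv_symm i j]; ring

theorem pd_contract (hG : IsMetricOn G U) (hη : SmoothOn η U) (hζ : SmoothOn ζ U) (hx : x ∈ U)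
    (j : Fin n) :
    pd j (contract G η ζ) x = ∑ k, covDeriv G η j k x * raise G ζ x k
      + ∑ k, covDeriv G ζ j k x * raise G η x k := by
  have h1 : pd j (contract G η ζ) x = ∑ k, pd j (fun y ↦ η y k) x * raise G ζ x k
      + ∑ k, η x k * pd j (fun y ↦ raise G ζ y k) x := by
    unfold contract
    rw [pd_sum fun k _ ↦ (hη x hx k).mul (hG.contDiffAt_raise hζ hx k), ← Finset.sum_add_distrib]
    exact Finset.sum_congr rfl fun k _ ↦ pd_mul (hη x hx k) (hG.contDiffAt_raise hζ hx k) j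
  -- Differentiating `ζₗ = ζᵏgₖₗ` avoids differentiating the inverse metric.
  have h2 (l : Fin n) : pd j (fun y ↦ ζ y l) x =
      ∑ k, pd j (fun y ↦ raise G ζ y k) x * G x k l
        + ∑ k, raise G ζ x k * pd j (fun y ↦ G y k l) x := by
    have : (fun y ↦ ζ y l) =ᶠ[nhds x] fun y ↦ ∑ k, raise G ζ y k * G y k l := by
      filter_upwards [hG.isOpen.mem_nhds hx] with y hy
      exact (hG.sum_raise_mul hy ζ l).symm
    rw [pd_congr this, pd_sum fun k _ ↦ (hG.contDiffAt_raise hζ hx k).mul (hG.contDiffAt x hx k l),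
      ← Finset.sum_add_distrib]
    exact Finset.sum_congr rfl fun k _ ↦
      pd_mul (hG.contDiffAt_raise hζ hx k) (hG.contDiffAt x hx k l) j
  have h3 : ∑ k, η x k * pd j (fun y ↦ raise G ζ y k) x =
      ∑ l, raise G η x l * (pd j (fun y ↦ ζ y l) x
        - ∑ k, raise G ζ x k * pd j (fun y ↦ G y k l) x) := by
    simp only [h2, add_sub_cancel_right, ← hG.sum_raise_mul hx η, Finset.sum_mul, Finset.mul_sum]
    rw [Finset.sum_comm]
    exact Finset.sum_congr rfl fun l _ ↦ Finset.sum_congr rfl fun k _ ↦ by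
      rw [hG.symm x k l]; ring
  have h4 : ∑ l, raise G η x l * ∑ k, raise G ζ x k * pd j (fun y ↦ G y k l) x =
      ∑ k, (∑ m, christoffel G m j k x * η x m) * raise G ζ x k
        + ∑ k, (∑ m, christoffel G m j k x * ζ x m) * raise G η x k := by
    have a1 : ∑ l, raise G η x l * ∑ k, raise G ζ x k * ∑ m, christoffel G m j k x * G x m l =
        ∑ k, (∑ m, christoffel G m j k x * η x m) * raise G ζ x k := by
      simp only [← hG.sum_raise_mul hx η, Finset.mul_sum, Finset.sum_mul]
      rw [Finset.sum_comm]
      refine Finset.sum_congr rfl fun k _ ↦ ?_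
      rw [Finset.sum_comm]
      exact Finset.sum_congr rfl fun m _ ↦ Finset.sum_congr rfl fun l _ ↦ by
        rw [hG.symm x m l]; ring
    have a2 : ∑ l, raise G η x l * ∑ k, raise G ζ x k * ∑ m, christoffel G m j l x * G x k m =
        ∑ k, (∑ m, christoffel G m j k x * ζ x m) * raise G η x k := by
      simp only [← hG.sum_raise_mul hx ζ, Finset.mul_sum, Finset.sum_mul]
      refine Finset.sum_congr rfl fun l _ ↦ ?_
      rw [Finset.sum_comm]
      exact Finset.sum_congr rfl fun m _ ↦ Finset.sum_congr rfl fun k _ ↦ by ring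
    rw [← a1, ← a2, ← Finset.sum_add_distrib]
    refine Finset.sum_congr rfl fun l _ ↦ ?_
    rw [← mul_add, ← Finset.sum_add_distrib]
    congr 1
    exact Finset.sum_congr rfl fun k _ ↦ by rw [hG.pd_metric hx, mul_add]
  simp only [covDeriv, sub_mul, Finset.sum_sub_distrib]
  rw [h1, h3]
  simp only [mul_sub, Finset.sum_sub_distrib]
  rw [h4]
  simp only [mul_comm (raise G η x _)]
  ring

/-- The Ricci identity for covectors. The Christoffel terms acting on the derivative indices are
left out: they cancel by absence of torsion. -/
theorem sum_riemannUp_mul (hG : IsMetricOn G U) (hη : SmoothOn η U) (hx : x ∈ U)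
    (i j k : Fin n) :
    ∑ p, riemannUp G i j k p x * η x p =
      (pd i (covDeriv G η j k) x - ∑ m, christoffel G m i k x * covDeriv G η j m x)
      - (pd j (covDeriv G η i k) x - ∑ m, christoffel G m j k x * covDeriv G η i m x) := by
  have h1 (i j : Fin n) : pd i (covDeriv G η j k) x = pd i (pd j (fun y ↦ η y k)) x
      - ∑ m, pd i (christoffel G m j k) x * η x m
      - ∑ m, christoffel G m j k x * pd i (fun y ↦ η y m) x := by
    have hs (m : Fin n) : ContDiffAt ℝ ∞ (fun y ↦ christoffel G m j k y * η y m) x :=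
      (hG.contDiffAt_christoffel hx m j k).mul (hη x hx m)
    unfold covDeriv
    rw [pd_sub (contDiffAt_pd (hη x hx k) j) (ContDiffAt.sum fun m _ ↦ hs m),
      pd_sum fun m _ ↦ hs m, sub_sub, ← Finset.sum_add_distrib]
    congr 1
    exact Finset.sum_congr rfl fun m _ ↦
      pd_mul (hG.contDiffAt_christoffel hx m j k) (hη x hx m) i
  have h2 (i j : Fin n) : ∑ m, christoffel G m i k x * covDeriv G η j m x =
      ∑ m, christoffel G m i k x * pd j (fun y ↦ η y m) x
        - ∑ p, (∑ q, christoffel G p j q x * christoffel G q i k x) * η x p := by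
    simp only [covDeriv, mul_sub, Finset.sum_sub_distrib, Finset.mul_sum, Finset.sum_mul]
    congr 1
    rw [Finset.sum_comm]
    exact Finset.sum_congr rfl fun m _ ↦ Finset.sum_congr rfl fun p _ ↦ by ring
  rw [h1 i j, h1 j i, h2, h2, pd_comm (hη x hx k) i j]
  simp only [riemannUp, neg_mul, add_mul, sub_mul, Finset.sum_sub_distrib, Finset.sum_add_distrib,
    Finset.sum_neg_distrib]
  ring

/-- The first Bianchi identity. -/
theorem riemannUp_cyclic (hG : IsMetricOn G U) (i j k p : Fin n) :
    riemannUp G i j k p x + riemannUp G j k i p x + riemannUp G k i j p x = 0 := by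
  have h (a b : Fin n) : christoffel G p a b = christoffel G p b a :=
    funext fun y ↦ hG.christoffel_symm p a b y
  simp only [riemannUp, Finset.sum_sub_distrib]
  simp only [h j i, h k i, h k j, fun q ↦ hG.christoffel_symm q j i x,
    fun q ↦ hG.christoffel_symm q k i x, fun q ↦ hG.christoffel_symm q k j x]
  ring

theorem sum_riemann_mul_raise (hG : IsMetricOn G U) (hx : x ∈ U) (η) (i j k : Fin n) :
    ∑ m, riemann G i j k m x * raise G η x m = ∑ p, riemannUp G i j k p x * η x p := by
  simp only [riemann, Finset.sum_mul, ← hG.sum_raise_mul hx η, Finset.mul_sum]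
  rw [Finset.sum_comm]
  exact Finset.sum_congr rfl fun p _ ↦ Finset.sum_congr rfl fun m _ ↦ by
    rw [hG.symm x p m]; ring

theorem sum_ricci_mul_raise (hG : IsMetricOn G U) (hx : x ∈ U) (η) (k : Fin n) :
    ∑ m, ricci G k m x * raise G η x m =
      ∑ j, ∑ l, (G x)⁻¹ j l * ∑ p, riemannUp G j k l p x * η x p := by
  simp only [← hG.sum_riemann_mul_raise hx, ricci, Finset.sum_mul, Finset.mul_sum]
  rw [Finset.sum_comm]
  refine Finset.sum_congr rfl fun j _ ↦ ?_
  rw [Finset.sum_comm]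
  exact Finset.sum_congr rfl fun l _ ↦ Finset.sum_congr rfl fun m _ ↦ by ring

end IsMetricOn

end MetricCalculus

/-! ### Curvature of doubly torqued covector fields -/

section Torqued

variable {n : ℕ} {G : EuclideanSpace ℝ (Fin n) → Matrix (Fin n) (Fin n) ℝ}
  {U : Set (EuclideanSpace ℝ (Fin n))} {x : EuclideanSpace ℝ (Fin n)}
  {τ α β : EuclideanSpace ℝ (Fin n) → Fin n → ℝ} {κ : EuclideanSpace ℝ (Fin n) → ℝ}

/-- The exterior derivative `∂ᵢ ηⱼ - ∂ⱼ ηᵢ`. -/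
noncomputable def curl (η : EuclideanSpace ℝ (Fin n) → Fin n → ℝ) (i j : Fin n)
    (x : EuclideanSpace ℝ (Fin n)) : ℝ :=
  pd i (fun y ↦ η y j) x - pd j (fun y ↦ η y i) x

/-- The coordinate form of a doubly torqued covector field on `U`. -/
structure IsTorquedOn (G : EuclideanSpace ℝ (Fin n) → Matrix (Fin n) (Fin n) ℝ)
    (τ α β : EuclideanSpace ℝ (Fin n) → Fin n → ℝ) (κ : EuclideanSpace ℝ (Fin n) → ℝ)
    (U : Set (EuclideanSpace ℝ (Fin n))) : Prop extends IsMetricOn G U where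
  smooth_τ : SmoothOn τ U
  smooth_α : SmoothOn α U
  smooth_β : SmoothOn β U
  smooth_κ : ∀ x ∈ U, ContDiffAt ℝ ∞ κ x
  covDeriv_eq : ∀ x ∈ U, ∀ j k,
    covDeriv G τ j k x = κ x * G x j k + α x j * τ x k + τ x j * β x k
  contract_α : ∀ x ∈ U, contract G α τ x = 0
  contract_β : ∀ x ∈ U, contract G β τ x = 0

/-- `βⱼ βₖ - ∇ⱼ βₖ`. -/
noncomputable def sqSubCovDeriv (G : EuclideanSpace ℝ (Fin n) → Matrix (Fin n) (Fin n) ℝ)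
    (β : EuclideanSpace ℝ (Fin n) → Fin n → ℝ) (j k : Fin n) (x : EuclideanSpace ℝ (Fin n)) : ℝ :=
  β x j * β x k - covDeriv G β j k x

theorem IsMetricOn.covDeriv_sub (hG : IsMetricOn G U) (η : EuclideanSpace ℝ (Fin n) → Fin n → ℝ)
    (i j : Fin n) : covDeriv G η i j x - covDeriv G η j i x = curl η i j x := by
  simp only [covDeriv, curl, fun m ↦ hG.christoffel_symm m i j x]
  ring

namespace IsTorquedOn

theorem sum_riemannUp_mul_eq (h : IsTorquedOn G τ α β κ U) (hx : x ∈ U) (i j k : Fin n) :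
    ∑ p, riemannUp G i j k p x * τ x p =
      (pd i κ x - κ x * α x i) * G x j k - (pd j κ x - κ x * α x j) * G x i k
        + curl α i j x * τ x k
        + τ x i * sqSubCovDeriv G β j k x - τ x j * sqSubCovDeriv G β i k x := by
  have key (i j : Fin n) :
      pd i (covDeriv G τ j k) x - ∑ m, christoffel G m i k x * covDeriv G τ j m x =
        pd i κ x * G x j k + κ x * ∑ m, christoffel G m i j x * G x m k
        + pd i (fun y ↦ α y j) x * τ x k + α x j * covDeriv G τ i k x
        + pd i (fun y ↦ τ y j) x * β x k + τ x j * covDeriv G β i k x := by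
    have h1 : pd i (covDeriv G τ j k) x =
        pd i κ x * G x j k + κ x * pd i (fun y ↦ G y j k) x
        + (pd i (fun y ↦ α y j) x * τ x k + α x j * pd i (fun y ↦ τ y k) x)
        + (pd i (fun y ↦ τ y j) x * β x k + τ x j * pd i (fun y ↦ β y k) x) := by
      have he : covDeriv G τ j k =ᶠ[nhds x]
          fun y ↦ κ y * G y j k + α y j * τ y k + τ y j * β y k := by
        filter_upwards [h.isOpen.mem_nhds hx] with y hy
        exact h.covDeriv_eq y hy j k
      have c1 := h.smooth_κ x hx
      have c2 := h.contDiffAt x hx j k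
      have c3 := h.smooth_α x hx j
      have c4 := h.smooth_τ x hx
      have c5 := h.smooth_β x hx k
      rw [pd_congr he, pd_add ((c1.mul c2).add (c3.mul (c4 k))) ((c4 j).mul c5),
        pd_add (c1.mul c2) (c3.mul (c4 k)), pd_mul c1 c2, pd_mul c3 (c4 k), pd_mul (c4 j) c5]
    have h2 : ∑ m, christoffel G m i k x * covDeriv G τ j m x =
        κ x * ∑ m, christoffel G m i k x * G x j m
        + α x j * ∑ m, christoffel G m i k x * τ x m
        + τ x j * ∑ m, christoffel G m i k x * β x m := by
      simp only [h.covDeriv_eq x hx, Finset.mul_sum, ← Finset.sum_add_distrib]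
      exact Finset.sum_congr rfl fun m _ ↦ by ring
    rw [h1, h2, h.pd_metric hx]
    simp only [covDeriv]
    ring
  -- By absence of torsion, `dτ` is the antisymmetrised torqued equation. In `dτ · βₖ` the `α` terms
  -- cancel those from `αⱼ∇ᵢτₖ`, and the `β` terms supply the `ββ` part of `S`.
  have hs : curl τ i j x = covDeriv G τ i j x - covDeriv G τ j i x :=
    (h.covDeriv_sub τ i j).symm
  rw [h.sum_riemannUp_mul h.smooth_τ hx, key, key]
  simp only [fun m ↦ h.christoffel_symm m j i x]
  simp only [h.covDeriv_eq x hx, curl, h.symm x j i] at hs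
  simp only [h.covDeriv_eq x hx, curl, sqSubCovDeriv]
  linear_combination β x k * hs

theorem pd_contract_self (h : IsTorquedOn G τ α β κ U) (hx : x ∈ U) (j : Fin n) :
    pd j (contract G τ τ) x = 2 * (κ x * τ x j + α x j * contract G τ τ x) := by
  have h1 : ∑ k, covDeriv G τ j k x * raise G τ x k =
      κ x * ∑ k, raise G τ x k * G x k j + α x j * contract G τ τ x
        + τ x j * contract G β τ x := by
    simp only [h.covDeriv_eq x hx, contract, Finset.mul_sum, ← Finset.sum_add_distrib]
    exact Finset.sum_congr rfl fun k _ ↦ by rw [h.symm x j k]; ring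
  rw [h.pd_contract h.smooth_τ h.smooth_τ hx, h1, h.sum_raise_mul hx, h.contract_β x hx]
  ring

/-- Equality of the mixed second derivatives of `N = τₖτᵏ`, computed from `dN = 2(κτ + Nα)`. -/
theorem curl_mul_contract (h : IsTorquedOn G τ α β κ U) (hx : x ∈ U) (i j : Fin n) :
    curl α i j x * contract G τ τ x =
      τ x i * (pd j κ x - κ x * α x j - κ x * β x j)
        - τ x j * (pd i κ x - κ x * α x i - κ x * β x i) := by
  have hN := h.contDiffAt_contract h.smooth_τ h.smooth_τ hx
  have c1 := h.smooth_κ x hx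
  have c3 := h.smooth_α x hx
  have c4 := h.smooth_τ x hx
  have key (i j : Fin n) : pd i (pd j (contract G τ τ)) x =
      2 * (pd i κ x * τ x j + κ x * pd i (fun y ↦ τ y j) x
        + (pd i (fun y ↦ α y j) x * contract G τ τ x
          + α x j * (2 * (κ x * τ x i + α x i * contract G τ τ x)))) := by
    have he : pd j (contract G τ τ) =ᶠ[nhds x]
        fun y ↦ 2 * (κ y * τ y j + α y j * contract G τ τ y) := by
      filter_upwards [h.isOpen.mem_nhds hx] with y hy
      exact h.pd_contract_self hy j
    rw [pd_congr he, pd_mul contDiffAt_const ((c1.mul (c4 j)).add ((c3 j).mul hN)), pd_const,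
      pd_add (c1.mul (c4 j)) ((c3 j).mul hN), pd_mul c1 (c4 j), pd_mul (c3 j) hN,
      h.pd_contract_self hx]
    ring
  have hs : curl τ i j x = covDeriv G τ i j x - covDeriv G τ j i x :=
    (h.covDeriv_sub τ i j).symm
  have hc := pd_comm hN i j
  rw [key, key] at hc
  simp only [h.covDeriv_eq x hx, curl, h.symm x j i] at hs
  simp only [curl]
  linear_combination hc / 2 - κ x * hs

/-- Differentiating `βₖτᵏ = 0` trades `τᵏ∇ⱼβₖ` for `-βᵏ∇ⱼτₖ`. -/
theorem sum_sqSubCovDeriv_mul_raise (h : IsTorquedOn G τ α β κ U) (hx : x ∈ U) (j : Fin n) :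
    ∑ k, sqSubCovDeriv G β j k x * raise G τ x k = κ x * β x j + τ x j * contract G β β x := by
  have h0 : pd j (contract G β τ) x = 0 := by
    have he : contract G β τ =ᶠ[nhds x] fun _ ↦ 0 := by
      filter_upwards [h.isOpen.mem_nhds hx] with y hy
      exact h.contract_β y hy
    rw [pd_congr he, pd_const]
  have h1 : ∑ k, covDeriv G τ j k x * raise G β x k =
      κ x * ∑ k, raise G β x k * G x k j + α x j * contract G τ β x
        + τ x j * contract G β β x := by
    simp only [h.covDeriv_eq x hx, contract, Finset.mul_sum, ← Finset.sum_add_distrib]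
    exact Finset.sum_congr rfl fun k _ ↦ by rw [h.symm x j k]; ring
  have h2 : ∑ k, sqSubCovDeriv G β j k x * raise G τ x k =
      β x j * contract G β τ x - ∑ k, covDeriv G β j k x * raise G τ x k := by
    simp only [sqSubCovDeriv, contract, Finset.mul_sum, ← Finset.sum_sub_distrib]
    exact Finset.sum_congr rfl fun k _ ↦ by ring
  rw [h.pd_contract h.smooth_β h.smooth_τ hx, h1, h.sum_raise_mul hx, h.contract_comm τ β,
    h.contract_β x hx] at h0
  rw [h2, h.contract_β x hx]
  linear_combination -h0

theorem exists_sum_ricci_mul_raise (h : IsTorquedOn G τ α β κ U) (hx : x ∈ U) :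
    ∃ s : ℝ, ∀ j, ∑ m, ricci G j m x * raise G τ x m =
      -((n : ℝ) - 1) * (pd j κ x - κ x * α x j) + ∑ i, curl α i j x * raise G τ x i
        + κ x * β x j + s * τ x j := by
  -- The multiples of `τ` come from `τⁱSⱼₖ` contracted (`e4`) and the trace of `S` (`e5`); `e1` and
  -- `e2` combine to `1 - n`.
  refine ⟨contract G β β x - ∑ i, ∑ k, (G x)⁻¹ i k * sqSubCovDeriv G β i k x, fun j ↦ ?_⟩
  rw [h.sum_ricci_mul_raise hx]
  simp only [h.sum_riemannUp_mul_eq hx]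
  have e1 : ∑ i, ∑ k, (G x)⁻¹ i k * ((pd i κ x - κ x * α x i) * G x j k) =
      pd j κ x - κ x * α x j := by
    have (i : Fin n) : ∑ k, (G x)⁻¹ i k * ((pd i κ x - κ x * α x i) * G x j k) =
        (pd i κ x - κ x * α x i) * if i = j then 1 else 0 := by
      rw [← h.sum_inv_mul hx, Finset.mul_sum]
      exact Finset.sum_congr rfl fun k _ ↦ by rw [h.symm x j k]; ring
    simp [this]
  have e2 : ∑ i, ∑ k, (G x)⁻¹ i k * ((pd j κ x - κ x * α x j) * G x i k) =
      n * (pd j κ x - κ x * α x j) := by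
    have (i : Fin n) : ∑ k, (G x)⁻¹ i k * ((pd j κ x - κ x * α x j) * G x i k) =
        (pd j κ x - κ x * α x j) * if i = i then 1 else 0 := by
      rw [← h.sum_inv_mul hx, Finset.mul_sum]
      exact Finset.sum_congr rfl fun k _ ↦ by rw [h.symm x i k]; ring
    simp [this, mul_sub]
  have e3 : ∑ i, ∑ k, (G x)⁻¹ i k * (curl α i j x * τ x k) =
      ∑ i, curl α i j x * raise G τ x i := by
    simp only [raise, Finset.mul_sum]
    exact Finset.sum_congr rfl fun i _ ↦ Finset.sum_congr rfl fun k _ ↦ by ring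
  have e4 : ∑ i, ∑ k, (G x)⁻¹ i k * (τ x i * sqSubCovDeriv G β j k x) =
      κ x * β x j + τ x j * contract G β β x := by
    rw [← h.sum_sqSubCovDeriv_mul_raise hx, Finset.sum_comm]
    simp only [raise, Finset.mul_sum]
    exact Finset.sum_congr rfl fun i _ ↦ Finset.sum_congr rfl fun k _ ↦ by
      rw [h.inv_symm k i]; ring
  have e5 : ∑ i, ∑ k, (G x)⁻¹ i k * (τ x j * sqSubCovDeriv G β i k x) =
      τ x j * ∑ i, ∑ k, (G x)⁻¹ i k * sqSubCovDeriv G β i k x := by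
    simp only [Finset.mul_sum]
    exact Finset.sum_congr rfl fun i _ ↦ Finset.sum_congr rfl fun k _ ↦ by ring
  simp only [mul_add, mul_sub, Finset.sum_add_distrib, Finset.sum_sub_distrib] at e1 e2 ⊢
  linear_combination e1 - e2 + e3 + e4 - e5

theorem weyl_compatible (h : IsTorquedOn G τ α β κ U) (hx : x ∈ U) (hn : 3 ≤ n)
    (hN : contract G τ τ x ≠ 0) (i j k l : Fin n) :
    τ x i * ∑ m, weyl G j k l m x * raise G τ x m
      + τ x j * ∑ m, weyl G k i l m x * raise G τ x m
      + τ x k * ∑ m, weyl G i j l m x * raise G τ x m = 0 := by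
  obtain ⟨s, hs⟩ := h.exists_sum_ricci_mul_raise hx
  set A : Fin n → ℝ := fun j ↦ pd j κ x - κ x * α x j with hA
  set N := contract G τ τ x with hNdef
  have hF (i j : Fin n) : curl α i j x =
      (τ x i * (A j - κ x * β x j) - τ x j * (A i - κ x * β x i)) / N := by
    rw [eq_div_iff hN]
    exact h.curl_mul_contract hx i j
  have hn2 : (n : ℝ) - 2 ≠ 0 := by
    have : (3 : ℝ) ≤ n := by exact_mod_cast hn
    linarith
  obtain ⟨t, ht⟩ : ∃ t : ℝ, ∀ j, ∑ m, ricci G j m x * raise G τ x m =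
      -((n : ℝ) - 2) * A j + t * τ x j := by
    -- Contracting `N dα = τ ∧ (A - κβ)` with `τ` adds `A - κβ` plus a multiple of `τ`: this turns
    -- `-(n-1)` into `-(n-2)` and removes `κβ`.
    refine ⟨s - (∑ i, (A i - κ x * β x i) * raise G τ x i) / N, fun j ↦ ?_⟩
    have e : ∑ i, curl α i j x * raise G τ x i = (A j - κ x * β x j)
        - τ x j * (∑ i, (A i - κ x * β x i) * raise G τ x i) / N := by
      have : ∑ i, curl α i j x * raise G τ x i = ((A j - κ x * β x j) * N
        - τ x j * ∑ i, (A i - κ x * β x i) * raise G τ x i) / N := by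
        simp only [hF, hNdef, contract, Finset.mul_sum, ← Finset.sum_sub_distrib, Finset.sum_div]
        exact Finset.sum_congr rfl fun i _ ↦ by ring
      rw [this, sub_div, mul_div_cancel_right₀ _ hN]
    rw [hs, e]
    ring
  have hW (j k l : Fin n) : ∑ m, weyl G j k l m x * raise G τ x m =
      ∑ p, riemannUp G j k l p x * τ x p
      + 1 / ((n : ℝ) - 2) * (τ x j * ricci G k l x - τ x k * ricci G j l x
        + G x k l * ∑ m, ricci G j m x * raise G τ x m
        - G x j l * ∑ m, ricci G k m x * raise G τ x m)
      - scalarCurv G x / (((n : ℝ) - 1) * ((n : ℝ) - 2))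
        * (τ x j * G x k l - τ x k * G x j l) := by
    rw [← h.sum_riemann_mul_raise hx, ← h.sum_raise_mul hx τ j, ← h.sum_raise_mul hx τ k]
    simp only [weyl, Finset.mul_sum, Finset.sum_mul, ← Finset.sum_sub_distrib,
      ← Finset.sum_add_distrib]
    exact Finset.sum_congr rfl fun m _ ↦ by rw [h.symm x m j, h.symm x m k]; ring
  have hR (j k l : Fin n) : ∑ p, riemannUp G j k l p x * τ x p =
      A j * G x k l - A k * G x j l + curl α j k x * τ x l
        + τ x j * sqSubCovDeriv G β k l x - τ x k * sqSubCovDeriv G β j l x :=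
    h.sum_riemannUp_mul_eq hx j k l
  -- The factor `1/(n-2)` makes the `A` terms of Riemann and Ricci cancel. What is left has the form
  -- `τⱼXₖₗ - τₖXⱼₗ` or contains `τ ∧ dα`, and dies in the cyclic sum.
  simp only [hW, hR, ht, hF]
  field_simp
  ring

theorem riemann_compatible_of_curl (h : IsTorquedOn G τ α β κ U) (hx : x ∈ U) {i j k : Fin n}
    (hA : ∀ i, pd i κ x - κ x * α x i = 0)
    (hF : τ x i * curl α j k x + τ x j * curl α k i x + τ x k * curl α i j x = 0) (l : Fin n) :
    τ x i * ∑ m, riemann G j k l m x * raise G τ x m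
      + τ x j * ∑ m, riemann G k i l m x * raise G τ x m
      + τ x k * ∑ m, riemann G i j l m x * raise G τ x m = 0 := by
  simp only [h.sum_riemann_mul_raise hx, h.sum_riemannUp_mul_eq hx, hA]
  linear_combination τ x l * hF

theorem null_κ (h : IsTorquedOn G τ α β κ U) (hN : ∀ y ∈ U, contract G τ τ y = 0)
    (hτ : ∀ y ∈ U, ∃ i, τ y i ≠ 0) (hx : x ∈ U) : κ x = 0 := by
  obtain ⟨i, hi⟩ := hτ x hx
  have he : contract G τ τ =ᶠ[nhds x] fun _ ↦ 0 := by
    filter_upwards [h.isOpen.mem_nhds hx] with y hy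
    exact hN y hy
  have h1 := h.pd_contract_self hx i
  rw [pd_congr he, pd_const, hN x hx] at h1
  have h2 : κ x * τ x i = 0 := by linarith
  exact (mul_eq_zero.mp h2).resolve_right hi

theorem null_pd_κ (h : IsTorquedOn G τ α β κ U) (hN : ∀ y ∈ U, contract G τ τ y = 0)
    (hτ : ∀ y ∈ U, ∃ i, τ y i ≠ 0) (hx : x ∈ U) (i : Fin n) : pd i κ x = 0 := by
  have he : κ =ᶠ[nhds x] fun _ ↦ 0 := by
    filter_upwards [h.isOpen.mem_nhds hx] with y hy
    exact h.null_κ hN hτ hy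
  rw [pd_congr he, pd_const]

/-- First Bianchi identity applied to the curvature formula: the `A` terms cancel by symmetry of
`g`, and antisymmetrising `S` leaves `-dβ`. -/
theorem curl_cyclic (h : IsTorquedOn G τ α β κ U) (hx : x ∈ U) (i j k : Fin n) :
    τ x i * (curl α j k x - curl β j k x) + τ x j * (curl α k i x - curl β k i x)
      + τ x k * (curl α i j x - curl β i j x) = 0 := by
  have hB : ∑ p, riemannUp G i j k p x * τ x p + ∑ p, riemannUp G j k i p x * τ x p
      + ∑ p, riemannUp G k i j p x * τ x p = 0 := by
    simp only [← Finset.sum_add_distrib, ← add_mul, h.riemannUp_cyclic, zero_mul,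
      Finset.sum_const_zero]
  simp only [h.sum_riemannUp_mul_eq hx, sqSubCovDeriv, h.symm x j i, h.symm x k i,
    h.symm x k j] at hB
  linear_combination hB + τ x i * h.covDeriv_sub (x := x) β j k
    + τ x j * h.covDeriv_sub (x := x) β k i + τ x k * h.covDeriv_sub (x := x) β i j

theorem ricci_eigenvector (h : IsTorquedOn G τ α β κ U) (hx : x ∈ U)
    (hκ : κ x = 0) (hA : ∀ i, pd i κ x - κ x * α x i = 0) (hN : contract G τ τ x = 0)
    (hτ : ∃ i, τ x i ≠ 0)
    (hF : ∀ i j k, τ x i * curl α j k x + τ x j * curl α k i x + τ x k * curl α i j x = 0) :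
    ∃ μ : ℝ, ∀ k, ∑ m, ricci G k m x * raise G τ x m = μ * τ x k := by
  obtain ⟨s, hs⟩ := h.exists_sum_ricci_mul_raise hx
  obtain ⟨a, ha⟩ := hτ
  -- Contract `τ ∧ dα = 0` with `τⁱ`; the term in `τᵢτⁱ` drops out because `τ` is null.
  have hv (j k : Fin n) : τ x k * ∑ i, curl α i j x * raise G τ x i =
      τ x j * ∑ i, curl α i k x * raise G τ x i := by
    have e : ∑ i, (τ x i * curl α j k x + τ x j * curl α k i x + τ x k * curl α i j x)
        * raise G τ x i = contract G τ τ x * curl α j k x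
        - τ x j * ∑ i, curl α i k x * raise G τ x i
        + τ x k * ∑ i, curl α i j x * raise G τ x i := by
      simp only [contract, Finset.mul_sum, Finset.sum_mul, ← Finset.sum_sub_distrib,
        ← Finset.sum_add_distrib, curl]
      exact Finset.sum_congr rfl fun i _ ↦ by ring
    simp only [hF, hN, zero_mul, Finset.sum_const_zero] at e
    linarith
  -- The proportionality factor is read off at an index `a` with `τₐ ≠ 0`.
  refine ⟨(∑ i, curl α i a x * raise G τ x i) / τ x a + s, fun k ↦ ?_⟩
  rw [hs, hA, hκ]
  have := hv k a
  field_simp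
  linear_combination this

end IsTorquedOn

end Torqued

/-! ### From the manifold to a chart -/

section Manifold

variable {n : ℕ} {M : Type*} [TopologicalSpace M]
  [ChartedSpace (EuclideanSpace ℝ (Fin n)) M] [IsManifold (𝓡 n) ∞ M]
  {e : OpenPartialHomeomorph M (EuclideanSpace ℝ (Fin n))}

theorem IsDoublyTorqued.isTorquedOn {g : LorentzMetric n M} {τ α β : OneForm n M} {κ : M → ℝ}
    (hκ : ContMDiff (𝓡 n) 𝓘(ℝ, ℝ) ∞ κ) (hτ : IsDoublyTorqued g τ κ α β)
    (he : e ∈ IsManifold.maximalAtlas (𝓡 n) ∞ M) :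
    IsTorquedOn (g.comp e) (τ.comp e) (α.comp e) (β.comp e) (fun y ↦ κ (e.symm y)) e.target where
  isOpen := e.open_target
  contDiffAt _ hx i j := g.contDiffAt_comp he hx i j
  symm _ i j := g.comp_symm i j
  det_ne_zero _ hx := g.det_comp_ne_zero he hx
  smooth_τ _ hx i := τ.contDiffAt_comp he hx i
  smooth_α _ hx i := α.contDiffAt_comp he hx i
  smooth_β _ hx i := β.contDiffAt_comp he hx i
  smooth_κ _ hx := contDiffAt_comp_symm hκ he hx
  covDeriv_eq x hx := (hτ e he x hx).1
  contract_α x hx := (hτ e he x hx).2.1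
  contract_β x hx := (hτ e he x hx).2.2

theorem curl_comp_of_eq_smul {α β : OneForm n M} {C : ℝ} (hC : ∀ p, β.val p = C • α.val p)
    (he : e ∈ IsManifold.maximalAtlas (𝓡 n) ∞ M) {x : EuclideanSpace ℝ (Fin n)}
    (hx : x ∈ e.target) (i j : Fin n) :
    curl (β.comp e) i j x = C * curl (α.comp e) i j x := by
  have h1 (k : Fin n) : (fun y ↦ β.comp e y k) = fun y ↦ C * α.comp e y k := by
    ext y
    simp [OneForm.comp, hC]
  simp only [curl, h1, pd_mul contDiffAt_const (α.contDiffAt_comp he hx _), pd_const]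
  ring

end Manifold

end Spacetime

theorem mainTheorem2 {n : ℕ} {M : Type*} [TopologicalSpace M]
    [ChartedSpace (EuclideanSpace ℝ (Fin n)) M] [IsManifold (𝓡 n) ∞ M]
    (g : LorentzMetric n M) (τ α β : OneForm n M) (κ : M → ℝ)
    (hκ : ContMDiff (𝓡 n) 𝓘(ℝ, ℝ) ∞ κ)
    (hτ : IsDoublyTorqued g τ κ α β) :
    (3 ≤ n → IsTimelike g τ → IsWeylCompatible g τ) ∧
    (IsNull g τ →
      (IsClosedForm α ∨ ∃ C : ℝ, C ≠ 1 ∧ ∀ p, β.val p = C • α.val p) →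
      IsRiemannCompatible g τ ∧ IsRicciEigenvector g τ) := by
  refine ⟨fun hn ht e he x hx i j k l ↦
    (hτ.isTorquedOn hκ he).weyl_compatible hx hn (ht e he x hx).ne i j k l, fun hnull hab ↦ ?_⟩
  have hA (e) (he : e ∈ IsManifold.maximalAtlas (𝓡 n) ∞ M) (x) (hx : x ∈ e.target) :
      κ (e.symm x) = 0 ∧ ∀ i, pd i (fun y ↦ κ (e.symm y)) x - κ (e.symm x) * α.comp e x i = 0 := by
    have h := hτ.isTorquedOn hκ he
    have hne (y) (hy : y ∈ e.target) := τ.exists_comp_ne_zero hnull.1 he hy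
    have hz := h.null_κ (hnull.2 e he) hne hx
    refine ⟨hz, fun i ↦ ?_⟩
    rw [h.null_pd_κ (hnull.2 e he) hne hx, hz]
    ring
  have hF (e) (he : e ∈ IsManifold.maximalAtlas (𝓡 n) ∞ M) (x) (hx : x ∈ e.target) (i j k) :
      τ.comp e x i * curl (α.comp e) j k x + τ.comp e x j * curl (α.comp e) k i x
        + τ.comp e x k * curl (α.comp e) i j x = 0 := by
    rcases hab with hcl | ⟨C, hC1, hC⟩
    · have hc (a b) : curl (α.comp e) a b x = 0 := sub_eq_zero.mpr (hcl e he x hx a b)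
      simp [hc]
    · have h := (hτ.isTorquedOn hκ he).curl_cyclic hx i j k
      simp only [curl_comp_of_eq_smul hC he hx] at h
      have h1 : (1 - C) * (τ.comp e x i * curl (α.comp e) j k x
          + τ.comp e x j * curl (α.comp e) k i x + τ.comp e x k * curl (α.comp e) i j x) = 0 := by
        linear_combination h
      exact (mul_eq_zero.mp h1).resolve_left (sub_ne_zero.mpr hC1.symm)
  refine ⟨fun e he x hx i j k l ↦ ?_, hnull.1, fun e he x hx ↦ ?_⟩
  · exact (hτ.isTorquedOn hκ he).riemann_compatible_of_curl hx (hA e he x hx).2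
      (hF e he x hx i j k) l
  · exact (hτ.isTorquedOn hκ he).ricci_eigenvector hx (hA e he x hx).1 (hA e he x hx).2
      (hnull.2 e he x hx) (τ.exists_comp_ne_zero hnull.1 he hx) (hF e he x hx)
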